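/- Let $M$ be a $C^\infty$ manifold of dimension $n\ge 3$. A Finsler metric on $M$ is a function $F:TM\to[0,\infty)$ that is $C^\infty$ off the zero section, positively $1$-homogeneous on the fibres, and whose fundamental form $\mathbf g_y(u,v)=\frac12\frac{\partial^2}{\partial s\,\partial t}F^2(y+su+tv)|_{s=t=0}$ is positive definite for every $y\neq 0$. Its Cartan torsion is $\mathbf C_y(u,v,w)=\frac12\frac{d}{dt}\mathbf g_{y+tw}(u,v)|_{t=0}$, with components $C_{ijk}$. The mean Cartan torsion $\mathbf I_y$ has components $I_i=g^{jk}C_{ijk}$, $\|\mathbf I\|^2=g^{ij}I_iI_j$, and the angular form is $h_{ij}=g_{ij}-F^{-2}g_{ip}y^pg_{jq}y^q$. $F$ is called semi-C-reducible if there are scalar functions $p,q$ on $TM\setminus\{0\}$ such that, at every $y\neq0$ with $\mathbf I_y\neq 0$, $p+q=1$ and $$C_{ijk}=\frac{p}{n+1}\{h_{ij}I_k+h_{jk}I_i+h_{ki}I_j\}+\frac{q}{\|\mathbf I\|^2}I_iI_jI_k ,$$ and it is called C2-like if this holds with $p=0$. A Randers metric is a metric $F=\alpha+\beta$, where $\alpha=\sqrt{a_{ij}(x)y^iy^j}$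 is a Riemannian metric and $\beta=b_i(x)y^i$ is a $1$-form (possibly zero) with $\|\beta\|_\alpha=\sqrt{a^{ij}b_ib_j}<1$. An $(\alpha,\beta)$-metric is a Finsler metric of the form $F=\alpha\,\phi(\beta/\alpha)$, where $\alpha$ is a Riemannian metric, $\beta$ is a $1$-form, $\phi$ is a $C^\infty$ function on $(-b_0,b_0)$ with $0<b_0\le\infty$, and $\|\beta\|_\alpha<b_0$ on $M$. All Riemannian metrics and $1$-forms are $C^\infty$. Let $F=\alpha\,\phi(\beta/\alpha)$ be an $(\alpha,\beta)$-metric on $M$ that is not a Randers metric. Then $F$ is not C2-like. -/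

import Mathlib

open scoped Manifold ContDiff Bundle
open Bundle

noncomputable section

namespace Finsler

/-! ### Multilinear algebra on `ℝⁿ` in the standard basis -/

/-- The standard basis of the model space. For a point `x` of an `n`-manifold it is the coordinate
basis `∂/∂x¹, …, ∂/∂xⁿ` of `TangentSpace (𝓡 n) x` in the preferred chart at `x`. -/
def coordVec {n : ℕ} (i : Fin n) : EuclideanSpace ℝ (Fin n) :=
  EuclideanSpace.single i 1

/-- The matrix `(B_{ij})` of a bilinear form `B`. -/
def gramMatrix {n : ℕ} (B : EuclideanSpace ℝ (Fin n) → EuclideanSpace ℝ (Fin n) → ℝ) :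
    Matrix (Fin n) (Fin n) ℝ :=
  Matrix.of fun i j => B (coordVec i) (coordVec j)

/-- The square `B^{ij} θ_i θ_j` of the norm of a covector `θ` with respect to an inner
product `B`, where `(B^{ij})` is the inverse of `(B_{ij})`. -/
def dualNormSq {n : ℕ} (B : EuclideanSpace ℝ (Fin n) → EuclideanSpace ℝ (Fin n) → ℝ)
    (θ : EuclideanSpace ℝ (Fin n) → ℝ) : ℝ :=
  ∑ i, ∑ j, (gramMatrix B)⁻¹ i j * θ (coordVec i) * θ (coordVec j)

variable {n : ℕ} {M : Type*} [TopologicalSpace M] [ChartedSpace (EuclideanSpace ℝ (Fin n)) M]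

/-! ### Tensors of a function on the tangent bundle -/

/-- The fundamental form
`g_y(u,v) = ½ ∂²/∂s∂t F²(y + s u + t v)` at `s = t = 0`, for `y, u, v ∈ T_x M`. -/
def fundamentalForm (F : TangentBundle (𝓡 n) M → ℝ) (x : M)
    (y u v : TangentSpace (𝓡 n) x) : ℝ :=
  (1 / 2) * deriv (fun s : ℝ => deriv (fun t : ℝ =>
    (F (TotalSpace.mk x (y + s • u + t • v))) ^ 2) 0) 0

/-- The Cartan torsion `C_y(u,v,w) = ½ d/dt g_{y + t w}(u,v)` at `t = 0`. -/
def cartanTorsion (F : TangentBundle (𝓡 n) M → ℝ) (x : M)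
    (y u v w : TangentSpace (𝓡 n) x) : ℝ :=
  (1 / 2) * deriv (fun t : ℝ => fundamentalForm F x (y + t • w) u v) 0

/-- The mean Cartan torsion `I_y(u) = g^{jk} C_y(u, ∂_j, ∂_k)`. -/
def meanCartanTorsion (F : TangentBundle (𝓡 n) M → ℝ) (x : M)
    (y u : TangentSpace (𝓡 n) x) : ℝ :=
  ∑ j, ∑ k, (gramMatrix (fundamentalForm F x y))⁻¹ j k *
    cartanTorsion F x y u (coordVec j) (coordVec k)

/-- `‖I_y‖² = g^{ij} I_i I_j`. -/
def meanCartanNormSq (F : TangentBundle (𝓡 n) M → ℝ) (x : M)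
    (y : TangentSpace (𝓡 n) x) : ℝ :=
  dualNormSq (fundamentalForm F x y) (meanCartanTorsion F x y)

/-- The angular form `h_y(u,v) = g_y(u,v) - F⁻² g_y(y,u) g_y(y,v)`. -/
def angularForm (F : TangentBundle (𝓡 n) M → ℝ) (x : M)
    (y u v : TangentSpace (𝓡 n) x) : ℝ :=
  fundamentalForm F x y u v -
    1 / (F (TotalSpace.mk x y)) ^ 2 * (fundamentalForm F x y y u * fundamentalForm F x y y v)

/-! ### Finsler metrics and their special classes -/

/-- Finsler metrics on an `n`-manifold: nonnegative functions on the tangent bundle, smooth off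
the zero section, positively `1`-homogeneous on the fibres, with positive definite
fundamental form. -/
structure IsFinslerMetric [IsManifold (𝓡 n) ∞ M] (F : TangentBundle (𝓡 n) M → ℝ) : Prop where
  nonneg : ∀ v, 0 ≤ F v
  smooth : ContMDiffOn (𝓡 n).tangent 𝓘(ℝ, ℝ) ∞ F {v | v.2 ≠ 0}
  homogeneous : ∀ (x : M) (y : TangentSpace (𝓡 n) x) (c : ℝ), 0 < c →
    F (TotalSpace.mk x (c • y)) = c * F (TotalSpace.mk x y)
  posDef : ∀ (x : M) (y : TangentSpace (𝓡 n) x), y ≠ 0 →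
    ∀ u : TangentSpace (𝓡 n) x, u ≠ 0 → 0 < fundamentalForm F x y u u

variable (n M) in
/-- Smooth Riemannian metrics on `M`. -/
abbrev RiemMetric [IsManifold (𝓡 n) ∞ M] : Type _ :=
  ContMDiffRiemannianMetric (𝓡 n) ∞ (EuclideanSpace ℝ (Fin n))
    (fun x : M => TangentSpace (𝓡 n) x)

variable (n M) in
/-- Smooth `1`-forms on `M`: smooth sections of the cotangent bundle. -/
abbrev OneForm [IsManifold (𝓡 n) ∞ M] : Type _ :=
  ContMDiffSection (𝓡 n) (EuclideanSpace ℝ (Fin n) →L[ℝ] ℝ) ∞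
    (fun x : M => TangentSpace (𝓡 n) x →L[ℝ] Bundle.Trivial M ℝ x)

/-- `α(x,y) = √(a_{ij}(x) yⁱ yʲ)`. -/
def riemNorm [IsManifold (𝓡 n) ∞ M] (a : RiemMetric n M) (v : TangentBundle (𝓡 n) M) : ℝ :=
  Real.sqrt (a.inner v.1 v.2 v.2)

/-- `β(x,y) = b_i(x) yⁱ`. -/
def OneForm.eval [IsManifold (𝓡 n) ∞ M] (β : OneForm n M) (v : TangentBundle (𝓡 n) M) : ℝ :=
  β v.1 v.2

/-- `‖β‖_α(x) = √(a^{ij}(x) b_i(x) b_j(x))`. -/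
def OneForm.normAt [IsManifold (𝓡 n) ∞ M] (β : OneForm n M) (a : RiemMetric n M) (x : M) : ℝ :=
  Real.sqrt (dualNormSq (fun u v : TangentSpace (𝓡 n) x => a.inner x u v)
    (fun u : TangentSpace (𝓡 n) x => β x u))

/-- `F` is the `(α,β)`-metric `α φ(β/α)`, where `φ` is smooth on `(-b₀, b₀)`, `0 < b₀ ≤ ∞`,
and `‖β‖_α < b₀`: such an expression is required to be a Finsler metric. -/
structure IsAlphaBetaMetric [IsManifold (𝓡 n) ∞ M] (F : TangentBundle (𝓡 n) M → ℝ)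
    (a : RiemMetric n M) (β : OneForm n M) (φ : ℝ → ℝ) (b₀ : EReal) : Prop where
  pos : 0 < b₀
  smooth : ContDiffOn ℝ ∞ φ {s : ℝ | -b₀ < (s : EReal) ∧ (s : EReal) < b₀}
  norm_lt : ∀ x, ((β.normAt a x : ℝ) : EReal) < b₀
  eq : ∀ v, F v = riemNorm a v * φ (β.eval v / riemNorm a v)
  finsler : IsFinslerMetric F

/-- `F` is a Randers metric: `F = α + β` for some Riemannian metric `α` and some `1`-form `β`
with `‖β‖_α < 1`. Riemannian metrics are the case `β = 0`. -/
def IsRandersMetric [IsManifold (𝓡 n) ∞ M] (F : TangentBundle (𝓡 n) M → ℝ) : Prop :=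
  ∃ (a : RiemMetric n M) (β : OneForm n M),
    (∀ x, β.normAt a x < 1) ∧ ∀ v, F v = riemNorm a v + β.eval v

/-- `F` is semi-C-reducible with the scalar functions `p` and `q`: `p + q = 1` and
`C_{ijk} = p/(n+1) (h_{ij} I_k + h_{jk} I_i + h_{ki} I_j) + q/‖I‖² I_i I_j I_k`.
The last term has a meaning, and `p` is determined, only where `I_y ≠ 0`; nothing is required
of the other tangent vectors. -/
def IsSemiCReducibleWith (F : TangentBundle (𝓡 n) M → ℝ) (p q : TangentBundle (𝓡 n) M → ℝ) :
    Prop :=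
  ∀ (x : M) (y : TangentSpace (𝓡 n) x), y ≠ 0 → meanCartanTorsion F x y ≠ 0 →
    p (TotalSpace.mk x y) + q (TotalSpace.mk x y) = 1 ∧
    ∀ u v w : TangentSpace (𝓡 n) x,
      cartanTorsion F x y u v w =
        p (TotalSpace.mk x y) / (n + 1) *
          (angularForm F x y u v * meanCartanTorsion F x y w +
            angularForm F x y v w * meanCartanTorsion F x y u +
            angularForm F x y w u * meanCartanTorsion F x y v) +
        q (TotalSpace.mk x y) / meanCartanNormSq F x y *
          (meanCartanTorsion F x y u * meanCartanTorsion F x y v * meanCartanTorsion F x y w)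

/-- `F` is C2-like: semi-C-reducible with `p = 0`. -/
def IsC2Like (F : TangentBundle (𝓡 n) M → ℝ) : Prop :=
  ∃ p q : TangentBundle (𝓡 n) M → ℝ,
    IsSemiCReducibleWith F p q ∧ ∀ v : TangentBundle (𝓡 n) M, v.2 ≠ 0 → p v = 0

end Finsler

end

noncomputable section

namespace Finsler

/-! ### Derivatives of a homogeneous function -/

section Calculus

variable {V : Type*} [NormedAddCommGroup V] [NormedSpace ℝ V]

-- On a tangent space where `β` is nonzero, let `e` be the `α`-unit vector representing `β` up to a
-- factor. The energy `E = F²/2` depends only on the `α`-norm and on the component along `e`. By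
-- homogeneity `E` off the axis is governed by `ψ(z) = E(f + z e)`, with `f` a unit vector
-- orthogonal to `e`. Put `σ = 2ψ - zψ'`, `τ = σ' = ψ' - zψ''` and `D = 2ψψ'' - ψ'²`; convexity of
-- `E` makes `ψ`, `σ` and `D` positive.
--
-- Since `n ≥ 3`, there is a unit vector `u` orthogonal to `e` and `f`. At `y = f + z e`, symmetry
-- gives `C(u,u,u) = 0` and `C(u,u,e) = τ/2`. If `C = κ I⊗I⊗I`, the first equation forces `κ I(u)² =
-- 0`, and then the second forces `τ = 0`. Hence `I(e) = 0` wherever `τ ≠ 0`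
-- (`IsC2Like.trace_eq_zero`).
--
-- By `trace_third`, `2 I(e) = (n-2) τ/σ + 2ψψ'''/D`. With `τ' = -zψ'''` this yields `(τ²)' = 2 z d
-- τ²` on the whole line, where `d = (n-2) D/(2σψ) > 0`. So `τ` vanishes identically or nowhere. In
-- the latter case `|τ|` is smallest at `z = 0`, the slope of `σ` keeps its sign and stays away from
-- zero, and `σ` cannot remain positive (`eq_zero_of_pos_of_sq_ode`). Therefore `τ = 0` and `ψ` is a
-- quadratic polynomial in `z` (`exists_quadratic_of_ode`).
--
-- Thus `F²` is a quadratic form on every such tangent space; where `β = 0` this is immediate. So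
-- `F` is Riemannian, a Randers metric with zero `1`-form (`isRandersMetric_of_sq_eq`).

scoped instance instNormedAddCommGroupDual : NormedAddCommGroup (V →L[ℝ] ℝ) :=
  ContinuousLinearMap.toNormedAddCommGroup

scoped instance instNormedSpaceDual : NormedSpace ℝ (V →L[ℝ] ℝ) :=
  ContinuousLinearMap.toNormedSpace

scoped instance instNormedAddCommGroupBilin : NormedAddCommGroup (V →L[ℝ] V →L[ℝ] ℝ) :=
  ContinuousLinearMap.toNormedAddCommGroup

scoped instance instNormedSpaceBilin : NormedSpace ℝ (V →L[ℝ] V →L[ℝ] ℝ) :=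
  ContinuousLinearMap.toNormedSpace

scoped instance instNormedAddCommGroupTrilin :
    NormedAddCommGroup (V →L[ℝ] V →L[ℝ] V →L[ℝ] ℝ) :=
  ContinuousLinearMap.toNormedAddCommGroup

scoped instance instNormedSpaceTrilin : NormedSpace ℝ (V →L[ℝ] V →L[ℝ] V →L[ℝ] ℝ) :=
  ContinuousLinearMap.toNormedSpace

/-- The second derivative of a function, `hess E y u v = D²E(y)(u, v)`. -/
abbrev hess (E : V → ℝ) : V → V →L[ℝ] V →L[ℝ] ℝ := fderiv ℝ (fderiv ℝ E)

/-- The third derivative of a function, `third E y w u v = D³E(y)(w, u, v)`. -/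
abbrev third (E : V → ℝ) : V → V →L[ℝ] V →L[ℝ] V →L[ℝ] ℝ := fderiv ℝ (hess E)

/-- Smoothness off the origin. -/
def SmoothOffZero (E : V → ℝ) : Prop := ∀ y : V, y ≠ 0 → ContDiffAt ℝ ∞ E y

namespace SmoothOffZero

variable {E : V → ℝ} (hE : SmoothOffZero E)
include hE

theorem contDiffAt_fderiv {y : V} (hy : y ≠ 0) : ContDiffAt ℝ ∞ (fderiv ℝ E) y :=
  (hE y hy).fderiv_right le_rfl

theorem contDiffAt_hess {y : V} (hy : y ≠ 0) : ContDiffAt ℝ ∞ (hess E) y :=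
  (hE.contDiffAt_fderiv hy).fderiv_right le_rfl

theorem contDiffAt_third {y : V} (hy : y ≠ 0) : ContDiffAt ℝ ∞ (third E) y :=
  (hE.contDiffAt_hess hy).fderiv_right le_rfl

theorem hasFDerivAt {y : V} (hy : y ≠ 0) : HasFDerivAt E (fderiv ℝ E y) y :=
  ((hE y hy).differentiableAt (by simp)).hasFDerivAt

theorem hasFDerivAt_fderiv {y : V} (hy : y ≠ 0) : HasFDerivAt (fderiv ℝ E) (hess E y) y :=
  ((hE.contDiffAt_fderiv hy).differentiableAt (by simp)).hasFDerivAt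

theorem hasFDerivAt_hess {y : V} (hy : y ≠ 0) : HasFDerivAt (hess E) (third E y) y :=
  ((hE.contDiffAt_hess hy).differentiableAt (by simp)).hasFDerivAt

variable {c : ℝ → V} {c' : V} {s : ℝ}

theorem hasDerivAt_comp (hc : HasDerivAt c c' s) (h0 : c s ≠ 0) :
    HasDerivAt (fun r => E (c r)) (fderiv ℝ E (c s) c') s :=
  (hE.hasFDerivAt h0).comp_hasDerivAt s hc

theorem hasDerivAt_fderiv {w : ℝ → V} {w' : V} (hc : HasDerivAt c c' s) (h0 : c s ≠ 0)
    (hw : HasDerivAt w w' s) :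
    HasDerivAt (fun r => fderiv ℝ E (c r) (w r))
      (hess E (c s) c' (w s) + fderiv ℝ E (c s) w') s :=
  ((hE.hasFDerivAt_fderiv h0).comp_hasDerivAt s hc).clm_apply hw

theorem hasDerivAt_hess {v w : ℝ → V} {v' w' : V} (hc : HasDerivAt c c' s) (h0 : c s ≠ 0)
    (hv : HasDerivAt v v' s) (hw : HasDerivAt w w' s) :
    HasDerivAt (fun r => hess E (c r) (v r) (w r))
      (third E (c s) c' (v s) (w s) + hess E (c s) v' (w s) + hess E (c s) (v s) w') s := by
  have := (((hE.hasFDerivAt_hess h0).comp_hasDerivAt s hc).clm_apply hv).clm_apply hw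
  simpa using this

omit hE in
theorem hasDerivAt_line (y u : V) (s : ℝ) : HasDerivAt (fun r : ℝ => y + r • u) u s := by
  simpa using ((hasDerivAt_id s).smul_const u).const_add y

omit hE in
theorem eventually_line_ne {y : V} (hy : y ≠ 0) (u : V) : ∀ᶠ r : ℝ in nhds 0, y + r • u ≠ 0 := by
  have : ContinuousAt (fun r : ℝ => y + r • u) 0 := (hasDerivAt_line y u 0).continuousAt
  exact this.eventually_ne (by simpa using hy)

theorem hess_symm {y : V} (hy : y ≠ 0) (u v : V) : hess E y u v = hess E y v u :=
  ((hE y hy).isSymmSndFDerivAt (by simp only [minSmoothness_of_isRCLikeNormedField]; exact WithTop.coe_le_coe.2 le_top)) u v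

theorem third_symm_left {y : V} (hy : y ≠ 0) (u v w : V) :
    third E y u v w = third E y v u w := by
  have := ((hE.contDiffAt_fderiv hy).isSymmSndFDerivAt (by simp only [minSmoothness_of_isRCLikeNormedField]; exact WithTop.coe_le_coe.2 le_top)) u v
  exact congrArg (fun A : V →L[ℝ] ℝ => A w) this

theorem hasDerivAt_hess_line {y : V} (hy : y ≠ 0) (u v w : V) :
    HasDerivAt (fun r : ℝ => hess E (y + r • w) u v) (third E y w u v) 0 := by
  simpa using hE.hasDerivAt_hess (hasDerivAt_line y w 0) (by simpa using hy)
    (hasDerivAt_const 0 u) (hasDerivAt_const 0 v)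

theorem third_symm_right {y : V} (hy : y ≠ 0) (u v w : V) :
    third E y u v w = third E y u w v := by
  refine (hE.hasDerivAt_hess_line hy v w u).unique
    ((hE.hasDerivAt_hess_line hy w v u).congr_of_eventuallyEq ?_)
  filter_upwards [eventually_line_ne hy u] with r hr
  exact hE.hess_symm hr v w

/-- The mixed second derivative at `0` of a function of two parameters is the second derivative. -/
theorem deriv_deriv {y : V} (hy : y ≠ 0) (u v : V) :
    deriv (fun s : ℝ => deriv (fun t : ℝ => E (y + s • u + t • v)) 0) 0 = hess E y u v := by
  have h1 : (fun s : ℝ => deriv (fun t : ℝ => E (y + s • u + t • v)) 0)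
      =ᶠ[nhds 0] fun s : ℝ => fderiv ℝ E (y + s • u) v := by
    filter_upwards [eventually_line_ne hy u] with s hs
    simpa using (hE.hasDerivAt_comp (hasDerivAt_line (y + s • u) v 0) (by simpa using hs)).deriv
  rw [h1.deriv_eq]
  simpa using (hE.hasDerivAt_fderiv (hasDerivAt_line y u 0) (by simpa using hy)
    (hasDerivAt_const 0 v)).deriv

variable (hom : ∀ (r : ℝ) (y : V), 0 < r → E (r • y) = r ^ 2 * E y)
include hom

/-- Euler's identity for `E`. -/
theorem fderiv_self {y : V} (hy : y ≠ 0) : fderiv ℝ E y y = 2 * E y := by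
  have h1 : HasDerivAt (fun r : ℝ => E (r • y)) (fderiv ℝ E y y) 1 := by
    have := hE.hasDerivAt_comp (c := fun r : ℝ => r • y) (s := 1)
      (by simpa using (hasDerivAt_id (1 : ℝ)).smul_const y) (by simpa using hy)
    simpa using this
  have h2 : HasDerivAt (fun r : ℝ => r ^ 2 * E y) (2 * E y) 1 := by
    simpa using (hasDerivAt_pow 2 (1 : ℝ)).mul_const (E y)
  refine h1.unique (h2.congr_of_eventuallyEq ?_)
  filter_upwards [lt_mem_nhds (zero_lt_one (α := ℝ))] with r hr
  exact hom r y hr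

/-- Euler's identity for the first derivative. -/
theorem hess_self {y : V} (hy : y ≠ 0) (v : V) : hess E y y v = fderiv ℝ E y v := by
  have h1 := hE.hasDerivAt_fderiv (hasDerivAt_line y v 0) (by simpa using hy)
    (hasDerivAt_line y v 0)
  have h2 := (hE.hasDerivAt_comp (hasDerivAt_line y v 0) (by simpa using hy)).const_mul 2
  have h3 := h1.unique (h2.congr_of_eventuallyEq (by
    filter_upwards [eventually_line_ne hy v] with r hr
    exact hE.fderiv_self hom hr))
  simp only [zero_smul, add_zero] at h3
  rw [hE.hess_symm hy y v]
  linarith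

/-- Euler's identity for the second derivative. -/
theorem third_self {y : V} (hy : y ≠ 0) (u v : V) : third E y u y v = 0 := by
  have h1 := hE.hasDerivAt_hess (hasDerivAt_line y u 0) (by simpa using hy)
    (hasDerivAt_line y u 0) (hasDerivAt_const 0 v)
  have h2 := hE.hasDerivAt_fderiv (hasDerivAt_line y u 0) (by simpa using hy)
    (hasDerivAt_const 0 v)
  have h3 := h1.unique (h2.congr_of_eventuallyEq (by
    filter_upwards [eventually_line_ne hy u] with r hr
    exact hE.hess_self hom hr v))
  simpa using h3

end SmoothOffZero

end Calculus

/-! ### Traces with respect to an inner product -/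

section Trace

variable {n : ℕ}

theorem sum_coordVec (v : EuclideanSpace ℝ (Fin n)) : ∑ i, v i • coordVec i = v := by
  ext j
  simp [coordVec, Finset.sum_apply, Pi.single_apply]

theorem sum_mul_apply_coordVec
    (B : EuclideanSpace ℝ (Fin n) →L[ℝ] EuclideanSpace ℝ (Fin n) →L[ℝ] ℝ)
    (v w : EuclideanSpace ℝ (Fin n)) : ∑ i, v i * B (coordVec i) w = B v w := by
  conv_rhs => rw [← sum_coordVec v]
  simp

theorem gramMatrix_mulVec (B : EuclideanSpace ℝ (Fin n) →L[ℝ] EuclideanSpace ℝ (Fin n) →L[ℝ] ℝ)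
    (v : EuclideanSpace ℝ (Fin n)) (i : Fin n) :
    (gramMatrix (fun u w => B u w)).mulVec v.ofLp i = B (coordVec i) v := by
  conv_rhs => rw [← sum_coordVec v]
  simp [gramMatrix, Matrix.mulVec, dotProduct, mul_comm]

/-- A vector `v` in the kernel of the Gram matrix would satisfy `B v v = 0`. -/
theorem isUnit_gramMatrix_det
    {B : EuclideanSpace ℝ (Fin n) →L[ℝ] EuclideanSpace ℝ (Fin n) →L[ℝ] ℝ}
    (hB : ∀ v, v ≠ 0 → 0 < B v v) : IsUnit (gramMatrix (fun u w => B u w)).det := by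
  rw [isUnit_iff_ne_zero]
  intro h
  obtain ⟨v, hv, hv0⟩ := Matrix.exists_mulVec_eq_zero_iff.2 h
  have hne : (WithLp.toLp 2 v : EuclideanSpace ℝ (Fin n)) ≠ 0 := by
    intro h0
    exact hv (by simpa using congrArg WithLp.ofLp h0)
  refine (hB _ hne).ne' ?_
  rw [← sum_mul_apply_coordVec]
  refine Finset.sum_eq_zero fun i _ => ?_
  rw [← gramMatrix_mulVec B (WithLp.toLp 2 v) i]
  simp [hv0]

/-- The `B`-trace of `B` is the dimension. -/
theorem sum_gramMatrix_inv_mul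
    {B : EuclideanSpace ℝ (Fin n) →L[ℝ] EuclideanSpace ℝ (Fin n) →L[ℝ] ℝ}
    (hs : ∀ u v, B u v = B v u) (hB : ∀ v, v ≠ 0 → 0 < B v v) :
    ∑ j, ∑ k, (gramMatrix (fun u w => B u w))⁻¹ j k * B (coordVec j) (coordVec k) = n := by
  have h := Matrix.nonsing_inv_mul _ (isUnit_gramMatrix_det hB)
  have h2 := congrArg Matrix.trace h
  rw [Matrix.trace_one, Fintype.card_fin] at h2
  rw [← h2]
  simp only [Matrix.trace, Matrix.diag, Matrix.mul_apply]
  refine Finset.sum_congr rfl fun j _ => Finset.sum_congr rfl fun k _ => ?_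
  rw [hs]
  rfl

/-- The `B`-trace of `B(x,·) ⊗ B(x,·)` is `B(x,x)`. -/
theorem sum_gramMatrix_inv_mul_mul
    {B : EuclideanSpace ℝ (Fin n) →L[ℝ] EuclideanSpace ℝ (Fin n) →L[ℝ] ℝ}
    (hB : ∀ v, v ≠ 0 → 0 < B v v) (x : EuclideanSpace ℝ (Fin n)) :
    ∑ j, ∑ k, (gramMatrix (fun u w => B u w))⁻¹ j k * (B (coordVec j) x * B (coordVec k) x)
      = B x x := by
  have h := Matrix.nonsing_inv_mul _ (isUnit_gramMatrix_det hB)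
  have h2 : ∀ j, ∑ k, (gramMatrix (fun u w => B u w))⁻¹ j k * B (coordVec k) x = x j := by
    intro j
    have h3 : (gramMatrix (fun u w => B u w))⁻¹.mulVec
        ((gramMatrix (fun u w => B u w)).mulVec x.ofLp) = x.ofLp := by
      rw [Matrix.mulVec_mulVec, h, Matrix.one_mulVec]
    have h4 := congrFun h3 j
    rw [← h4]
    simp only [Matrix.mulVec, dotProduct]
    refine Finset.sum_congr rfl fun k _ => ?_
    rw [← gramMatrix_mulVec]
    rfl
  calc _ = ∑ j, x j * B (coordVec j) x := by
        refine Finset.sum_congr rfl fun j _ => ?_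
        rw [← h2 j, Finset.sum_mul]
        exact Finset.sum_congr rfl fun k _ => by ring
    _ = B x x := sum_mul_apply_coordVec B x x

end Trace

/-! ### An ordinary differential equation -/

section ODE

/-- A nontrivial solution of `N' = k N` vanishes nowhere. -/
theorem eq_zero_of_linear_ode {N k : ℝ → ℝ} (hk : Continuous k)
    (hN : ∀ z, HasDerivAt N (k z * N z) z) {z₀ : ℝ} (h0 : N z₀ = 0) (z : ℝ) : N z = 0 := by
  have hK : ∀ z, HasDerivAt (fun z => ∫ t in z₀..z, k t) (k z) z := fun z =>
    intervalIntegral.integral_hasDerivAt_right (hk.intervalIntegrable _ _)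
      (hk.stronglyMeasurableAtFilter _ _) hk.continuousAt
  -- Integrating factor: `N exp(-∫k)` is constant, and it vanishes at `z₀`.
  have hP : ∀ z, HasDerivAt (fun z => N z * Real.exp (-∫ t in z₀..z, k t)) 0 z := by
    intro z
    refine ((hN z).mul (hK z).neg.exp).congr_deriv ?_
    ring
  have hconst := is_const_of_deriv_eq_zero (fun z => (hP z).differentiableAt)
    (fun z => (hP z).deriv) z z₀
  simp only [h0, zero_mul] at hconst
  exact (mul_eq_zero.1 hconst).resolve_right (Real.exp_pos _).ne'

/-- A positive function whose derivative `τ` satisfies `(τ²)' = 2 z d(z) τ²` with `d ≥ 0` is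
constant. -/
theorem eq_zero_of_pos_of_sq_ode {σ τ d : ℝ → ℝ} (hσ : ∀ z, 0 < σ z)
    (hσ' : ∀ z, HasDerivAt σ (τ z) z) (hτ : Continuous τ) (hd : Continuous d)
    (hd0 : ∀ z, 0 ≤ d z)
    (hN : ∀ z, HasDerivAt (fun z => τ z ^ 2) (2 * z * d z * τ z ^ 2) z) (z : ℝ) : τ z = 0 := by
  by_contra hz
  have hne : ∀ z, τ z ≠ 0 := by
    intro w hw
    have := eq_zero_of_linear_ode (k := fun z => 2 * z * d z) (by fun_prop) hN
      (z₀ := w) (by simp [hw]) z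
    exact hz (by simpa using this)
  have hcont : Continuous fun z => τ z ^ 2 := by fun_prop
  -- The sign of `2 z d τ²` is that of `z`, so `τ²` decreases up to `0` and increases afterwards.
  have hmin : ∀ z, τ 0 ^ 2 ≤ τ z ^ 2 := by
    intro z
    rcases le_total 0 z with h | h
    · refine monotoneOn_of_deriv_nonneg (convex_Ici 0) hcont.continuousOn
        (fun x _ => (hN x).differentiableAt.differentiableWithinAt) (fun x hx => ?_)
        Set.self_mem_Ici h h
      rw [(hN x).deriv]
      rw [interior_Ici] at hx
      have := hd0 x
      have hx0 : 0 < x := hx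
      positivity
    · refine antitoneOn_of_deriv_nonpos (convex_Iic 0) hcont.continuousOn
        (fun x _ => (hN x).differentiableAt.differentiableWithinAt) (fun x hx => ?_)
        h Set.self_mem_Iic h
      rw [(hN x).deriv]
      rw [interior_Iic] at hx
      have hx0 : x < 0 := hx
      have h1 := mul_nonneg (hd0 x) (sq_nonneg (τ x))
      nlinarith
  have habs : ∀ z, |τ 0| ≤ |τ z| := fun z => sq_le_sq.1 (hmin z)
  have hdiff : Differentiable ℝ σ := fun z => (hσ' z).differentiableAt
  have h00 : 0 < |τ 0| := abs_pos.2 (hne 0)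
  -- Within this distance from `0`, a slope of size at least `|τ 0|` uses up the value `σ 0`. The
  -- mean value theorem is applied to the left or to the right of `0`, on the side where `σ`
  -- decreases away from `0`.
  have hR : 0 < σ 0 / |τ 0| := div_pos (hσ 0) h00
  have hsign : (∀ z, 0 < τ z) ∨ ∀ z, τ z < 0 := by
    by_contra! h
    obtain ⟨⟨x, hx⟩, y, hy⟩ := h
    obtain ⟨w, hw⟩ := mem_range_of_exists_le_of_exists_ge hτ ⟨x, hx⟩ ⟨y, hy⟩
    exact hne w hw
  rcases hsign with hpos | hneg
  · obtain ⟨c, -, hc⟩ := exists_hasDerivAt_eq_slope σ τ (a := -(σ 0 / |τ 0|)) (b := 0)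
      (by linarith) hdiff.continuous.continuousOn (fun x _ => hσ' x)
    have h1 := habs c
    rw [abs_of_pos (hpos c), hc, le_div_iff₀ (by linarith)] at h1
    have h2 := hσ (-(σ 0 / |τ 0|))
    have h3 : |τ 0| * (σ 0 / |τ 0|) = σ 0 := by field_simp
    nlinarith
  · obtain ⟨c, -, hc⟩ := exists_hasDerivAt_eq_slope σ τ (a := 0) (b := σ 0 / |τ 0|)
      (by linarith) hdiff.continuous.continuousOn (fun x _ => hσ' x)
    have h1 := habs c
    rw [abs_of_neg (hneg c), hc, ← neg_div, le_div_iff₀ (by linarith)] at h1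
    have h2 := hσ (σ 0 / |τ 0|)
    have h3 : |τ 0| * (σ 0 / |τ 0|) = σ 0 := by field_simp
    nlinarith

/-- Here `ψ` stands for the energy along `f + z e`, the `ψᵢ` for its derivatives and `m` for `n -
2`. The relation `hrel` is needed only where `τ = ψ₁ - z ψ₂` is nonzero, because the conclusion is
drawn from an equation for `τ²`. -/
theorem exists_quadratic_of_ode {ψ ψ₁ ψ₂ ψ₃ : ℝ → ℝ} {m : ℝ} (hm : 0 < m)
    (h1 : ∀ z, HasDerivAt ψ (ψ₁ z) z) (h2 : ∀ z, HasDerivAt ψ₁ (ψ₂ z) z)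
    (h3 : ∀ z, HasDerivAt ψ₂ (ψ₃ z) z) (hc : Continuous ψ₃) (hψ : ∀ z, 0 < ψ z)
    (hσ : ∀ z, 0 < 2 * ψ z - z * ψ₁ z) (hD : ∀ z, 0 < 2 * ψ z * ψ₂ z - ψ₁ z ^ 2)
    (hrel : ∀ z, ψ₁ z - z * ψ₂ z ≠ 0 →
      m * (ψ₁ z - z * ψ₂ z) * (2 * ψ z * ψ₂ z - ψ₁ z ^ 2) +
        2 * (2 * ψ z - z * ψ₁ z) * ψ z * ψ₃ z = 0) :
    ∃ c k : ℝ, ∀ z, 2 * ψ z = c + k * z ^ 2 := by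
  have c0 : Continuous ψ := Differentiable.continuous (𝕜 := ℝ) fun z => (h1 z).differentiableAt
  have c1 : Continuous ψ₁ := Differentiable.continuous (𝕜 := ℝ) fun z => (h2 z).differentiableAt
  have c2 : Continuous ψ₂ := Differentiable.continuous (𝕜 := ℝ) fun z => (h3 z).differentiableAt
  have dσ : ∀ z, HasDerivAt (fun z => 2 * ψ z - z * ψ₁ z) (ψ₁ z - z * ψ₂ z) z := by
    intro z
    refine (((h1 z).const_mul 2).sub ((hasDerivAt_id' z).mul (h2 z))).congr_deriv ?_
    ring
  have dτ : ∀ z, HasDerivAt (fun z => ψ₁ z - z * ψ₂ z) (-(z * ψ₃ z)) z := by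
    intro z
    refine ((h2 z).sub ((hasDerivAt_id' z).mul (h3 z))).congr_deriv ?_
    ring
  have hτ : ∀ z, ψ₁ z - z * ψ₂ z = 0 := by
    refine eq_zero_of_pos_of_sq_ode (d := fun z =>
      m * (2 * ψ z * ψ₂ z - ψ₁ z ^ 2) / (2 * (2 * ψ z - z * ψ₁ z) * ψ z))
      hσ dσ (by fun_prop) ?_ ?_ ?_
    · refine Continuous.div (by fun_prop) (by fun_prop) fun z => ?_
      have := hσ z
      have := hψ z
      positivity
    · intro z
      have := hσ z
      have := hψ z
      have := hD z
      positivity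
    · intro z
      refine ((dτ z).pow 2).congr_deriv ?_
      -- At a zero of `τ` both sides vanish, since `(τ²)' = 2ττ'`.
      by_cases h : ψ₁ z - z * ψ₂ z = 0
      · simp [h]
      · have h4 := hrel z h
        have h5 := (hσ z).ne'
        have h6 := (hψ z).ne'
        generalize 2 * ψ z - z * ψ₁ z = S at h4 h5 ⊢
        field_simp
        simp only [Nat.add_one_sub_one, pow_one, Nat.cast_ofNat]
        linear_combination (-z * (ψ₁ z - z * ψ₂ z)) * h4
  -- From `τ' = -zψ₃ = 0` one gets `ψ₃ = 0` away from `z = 0`; continuity covers `z = 0`.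
  have hψ3 : ψ₃ = 0 := by
    refine Continuous.ext_on (dense_compl_singleton (0 : ℝ)) hc continuous_const ?_
    intro z hz
    have hz0 : z ≠ 0 := hz
    have h4 := (dτ z).unique ((hasDerivAt_const z (0 : ℝ)).congr_of_eventuallyEq
      (Filter.Eventually.of_forall hτ))
    simpa [hz0] using h4
  have hψ2 : ∀ z, ψ₂ z = ψ₂ 0 := fun z =>
    is_const_of_deriv_eq_zero (fun z => (h3 z).differentiableAt)
      (fun z => by rw [(h3 z).deriv, hψ3]; rfl) z 0
  have hσc : ∀ z, 2 * ψ z - z * ψ₁ z = 2 * ψ 0 - 0 * ψ₁ 0 := fun z =>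
    is_const_of_deriv_eq_zero (f := fun z => 2 * ψ z - z * ψ₁ z)
      (fun z => (dσ z).differentiableAt) (fun z => by rw [(dσ z).deriv, hτ]) z 0
  refine ⟨2 * ψ 0, ψ₂ 0, fun z => ?_⟩
  have h4 := hσc z
  have h5 := hτ z
  rw [hψ2 z] at h5
  linear_combination h4 + z * h5

end ODE

/-! ### Axially symmetric energies on a vector space -/

section Axial

open SmoothOffZero

variable {V : Type*} [NormedAddCommGroup V] [NormedSpace ℝ V]

/-- A positively `2`-homogeneous function `E` on `V`, smooth off `0` with positive definite second
derivative, which depends only on the norm of a vector for the inner product `a` and on its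
component along the unit vector `e`. -/
structure IsAxialEnergy (a : V →L[ℝ] V →L[ℝ] ℝ) (e : V) (E : V → ℝ) : Prop where
  smooth : SmoothOffZero E
  homogeneous : ∀ (r : ℝ) (y : V), 0 < r → E (r • y) = r ^ 2 * E y
  posDef : ∀ y, y ≠ 0 → ∀ u, u ≠ 0 → 0 < hess E y u u
  symm : ∀ u v, a u v = a v u
  pos : ∀ u, u ≠ 0 → 0 < a u u
  unit : a e e = 1
  axial : ∀ y y', a y y = a y' y' → a e y = a e y' → E y = E y'

namespace IsAxialEnergy

variable {a : V →L[ℝ] V →L[ℝ] ℝ} {e : V} {E : V → ℝ} (h : IsAxialEnergy a e E)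
include h

/-- The vectors `y + r u` and `y - r u` have the same norm and the same axial component, so `E` is
even in `r`. -/
theorem fderiv_eq_zero {y u : V} (hy : y ≠ 0) (h1 : a y u = 0) (h2 : a e u = 0) :
    fderiv ℝ E y u = 0 := by
  have d1 := h.smooth.hasDerivAt_comp (hasDerivAt_line y u 0) (by simpa using hy)
  have d2 := h.smooth.hasDerivAt_comp (hasDerivAt_line y (-u) 0) (by simpa using hy)
  have d3 := d1.unique (d2.congr_of_eventuallyEq (Filter.Eventually.of_forall fun r => by
    apply h.axial
    · have := h.symm u y
      simp [h1, this]
    · simp [h2]))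
  simp only [zero_smul, add_zero, map_neg] at d3
  linarith

theorem energy_pos {y : V} (hy : y ≠ 0) : 0 < E y := by
  have h1 := h.posDef y hy y hy
  rw [h.smooth.hess_self h.homogeneous hy, h.smooth.fderiv_self h.homogeneous hy] at h1
  linarith

theorem energy_zero : E 0 = 0 := by
  have := h.homogeneous 2 0 (by norm_num)
  rw [smul_zero] at this
  linarith

variable {f : V} (hf : a f f = 1) (hef : a e f = 0)
include hf hef

theorem line_ne_zero (z : ℝ) : f + z • e ≠ 0 := by
  intro h0
  have h1 := congrArg (a f) h0
  simp [hf, h.symm f e, hef] at h1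

section Perp

variable {u u' : V} (hu : a e u = 0) (hu2 : a f u = 0)
include hu hu2

omit hu in
theorem line_add_ne_zero (z s : ℝ) : f + z • e + s • u ≠ 0 := by
  intro h0
  have h1 := congrArg (a f) h0
  simp [hf, h.symm f e, hef, hu2] at h1

theorem fderiv_perp (z : ℝ) : fderiv ℝ E (f + z • e) u = 0 :=
  h.fderiv_eq_zero (h.line_ne_zero hf hef z) (by simp [hu, hu2]) hu

theorem hess_axis_perp (z : ℝ) : hess E (f + z • e) e u = 0 := by
  have d := h.smooth.hasDerivAt_fderiv (hasDerivAt_line f e z) (h.line_ne_zero hf hef z)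
    (hasDerivAt_const z u)
  have := d.unique ((hasDerivAt_const z (0 : ℝ)).congr_of_eventuallyEq
    (Filter.Eventually.of_forall (h.fderiv_perp hf hef hu hu2)))
  simpa using this

theorem third_axis_axis_perp (z : ℝ) : third E (f + z • e) e e u = 0 := by
  have d := h.smooth.hasDerivAt_hess (hasDerivAt_line f e z) (h.line_ne_zero hf hef z)
    (hasDerivAt_const z e) (hasDerivAt_const z u)
  have := d.unique ((hasDerivAt_const z (0 : ℝ)).congr_of_eventuallyEq
    (Filter.Eventually.of_forall (h.hess_axis_perp hf hef hu hu2)))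
  simpa using this

omit hu in
-- The correction `-s a(u,u') f` keeps the moving vector orthogonal to both `e` and the moving base
-- point `f + z e + s u`. Hence `dE` vanishes on it for every `s`, and the identity is the
-- derivative of that fact.
theorem hess_perp_line (hu' : a e u' = 0) (hu2' : a f u' = 0) (z s : ℝ) :
    hess E (f + z • e + s • u) u (u' + s • (-(a u u' • f))) +
      fderiv ℝ E (f + z • e + s • u) (-(a u u' • f)) = 0 := by
  have h0 := h.line_add_ne_zero hf hef hu2 z
  have d := h.smooth.hasDerivAt_fderiv (hasDerivAt_line (f + z • e) u s) (h0 s)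
    (hasDerivAt_line u' (-(a u u' • f)) s)
  refine d.unique ((hasDerivAt_const s (0 : ℝ)).congr_of_eventuallyEq
    (Filter.Eventually.of_forall fun r => h.fderiv_eq_zero (h0 r) ?_ ?_))
  · simp [hu2', hu', hf, hef, h.symm u f, hu2]
  · simp [hu', hef]

omit hu in
theorem hess_perp (hu' : a e u' = 0) (hu2' : a f u' = 0) (z : ℝ) :
    hess E (f + z • e) u u' = a u u' * fderiv ℝ E (f + z • e) f := by
  have := h.hess_perp_line hf hef hu2 hu' hu2' z 0
  simp only [zero_smul, add_zero, map_neg, map_smul, smul_eq_mul] at this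
  linarith

omit hu in
-- Derivative of `hess_perp` along the axis. With `u = u'` a unit vector it says `C(u,u,e) = τ/2`.
theorem third_axis_perp (hu' : a e u' = 0) (hu2' : a f u' = 0) (z : ℝ) :
    third E (f + z • e) e u u' = a u u' * hess E (f + z • e) e f := by
  have d := h.smooth.hasDerivAt_hess (hasDerivAt_line f e z) (h.line_ne_zero hf hef z)
    (hasDerivAt_const z u) (hasDerivAt_const z u')
  have d2 := (h.smooth.hasDerivAt_fderiv (hasDerivAt_line f e z) (h.line_ne_zero hf hef z)
    (hasDerivAt_const z f)).const_mul (a u u')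
  have := d.unique (d2.congr_of_eventuallyEq
    (Filter.Eventually.of_forall (h.hess_perp hf hef hu2 hu' hu2')))
  simpa using this

theorem hess_perp_self (z : ℝ) : hess E (f + z • e) u f = 0 := by
  have h0 := h.line_ne_zero hf hef z
  have h1 := h.smooth.hess_self h.homogeneous h0 u
  rw [h.fderiv_perp hf hef hu hu2] at h1
  simp only [map_add, map_smul, add_apply, smul_apply, h.hess_axis_perp hf hef hu hu2,
    smul_zero, add_zero] at h1
  rw [h.smooth.hess_symm h0, h1]

/-- Differentiating `hess_perp_line` once more at `s = 0` leaves, besides the third derivative, only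
multiples of `D²E(u,f)`, which is zero. -/
theorem third_perp (z : ℝ) : third E (f + z • e) u u u = 0 := by
  have h0 := h.line_add_ne_zero hf hef hu2 z
  have d1 := h.smooth.hasDerivAt_hess (hasDerivAt_line (f + z • e) u 0) (h0 0)
    (hasDerivAt_const 0 u) (hasDerivAt_line u (-(a u u • f)) 0)
  have d2 := h.smooth.hasDerivAt_fderiv (hasDerivAt_line (f + z • e) u 0) (h0 0)
    (hasDerivAt_const 0 (-(a u u • f)))
  have := (d1.add d2).unique ((hasDerivAt_const (0 : ℝ) (0 : ℝ)).congr_of_eventuallyEq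
    (Filter.Eventually.of_forall (h.hess_perp_line hf hef hu2 hu hu2 z)))
  simpa [h.hess_perp_self hf hef hu hu2] using this

end Perp

theorem hess_axis_self (z : ℝ) :
    hess E (f + z • e) e f =
      fderiv ℝ E (f + z • e) e - z * hess E (f + z • e) e e := by
  have h0 := h.line_ne_zero hf hef z
  have h1 := h.smooth.hess_self h.homogeneous h0 e
  rw [h.smooth.hess_symm h0] at h1
  simp only [map_add, map_smul, smul_eq_mul] at h1
  linarith

theorem fderiv_self_line (z : ℝ) :
    fderiv ℝ E (f + z • e) f = 2 * E (f + z • e) - z * fderiv ℝ E (f + z • e) e := by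
  have h1 := h.smooth.fderiv_self h.homogeneous (h.line_ne_zero hf hef z)
  simp only [map_add, map_smul, smul_eq_mul] at h1
  linarith

/-- The Hessian in the decomposition `v = A e + B y + u` of vectors, `y = f + z e`. -/
theorem hess_decomp {u u' : V} (hu : a e u = 0) (hu2 : a f u = 0) (hu' : a e u' = 0)
    (hu2' : a f u' = 0) (z A B A' B' : ℝ) :
    hess E (f + z • e) (A • e + B • (f + z • e) + u) (A' • e + B' • (f + z • e) + u') =
      A * A' * hess E (f + z • e) e e + (A * B' + A' * B) * fderiv ℝ E (f + z • e) e +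
        2 * B * B' * E (f + z • e) + a u u' * fderiv ℝ E (f + z • e) f := by
  have h0 := h.line_ne_zero hf hef z
  have e1 := h.hess_perp hf hef hu2 hu' hu2' z
  have e2 := h.hess_axis_perp hf hef hu hu2 z
  have e3 := h.hess_axis_perp hf hef hu' hu2' z
  have e4 := h.fderiv_perp hf hef hu hu2 z
  have e5 := h.fderiv_perp hf hef hu' hu2' z
  have e6 := h.smooth.fderiv_self h.homogeneous h0
  have e7 := h.smooth.hess_self h.homogeneous h0
  have e8 := h.smooth.hess_symm h0
  generalize f + z • e = y at *
  simp only [map_add, map_smul, add_apply, smul_apply, smul_eq_mul, e7, e8 u e, e8 u y, e8 e y,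
    e1, e2, e3, e4, e5, e6]
  ring

/-- The third derivative in the decomposition `v = A e + B y + u` of vectors, `y = f + z e`. -/
theorem third_decomp {u u' : V} (hu : a e u = 0) (hu2 : a f u = 0) (hu' : a e u' = 0)
    (hu2' : a f u' = 0) (z A B A' B' : ℝ) :
    third E (f + z • e) e (A • e + B • (f + z • e) + u) (A' • e + B' • (f + z • e) + u') =
      A * A' * third E (f + z • e) e e e + a u u' * hess E (f + z • e) e f := by
  have h0 := h.line_ne_zero hf hef z
  have e1 := h.third_axis_perp hf hef hu2 hu' hu2' z
  have e2 := h.third_axis_axis_perp hf hef hu hu2 z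
  have e3 := h.third_axis_axis_perp hf hef hu' hu2' z
  have e7 := h.smooth.third_self h.homogeneous h0 e
  have e8 := h.smooth.third_symm_right h0 e
  generalize f + z • e = y at *
  simp only [map_add, map_smul, add_apply, smul_apply, smul_eq_mul, e7, e8 u e, e8 u y, e8 e y,
    e1, e2, e3]
  ring

theorem exists_decomp (z : ℝ) (v : V) :
    ∃ (A B : ℝ) (u : V), a e u = 0 ∧ a f u = 0 ∧ v = A • e + B • (f + z • e) + u := by
  -- Expand `v` orthogonally along `e` and `f`, then substitute `f = y - z e`.
  refine ⟨a e v - z * a f v, a f v, v - a e v • e - a f v • f, ?_, ?_, ?_⟩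
  · simp [h.unit, hef]
  · simp [hf, h.symm f e, hef]
  · module

/-- This is the Gram determinant of `D²E` on the plane of `e` and `y = f + z e`, where `D²E(e,y) =
dE(e)` and `D²E(y,y) = 2E` by Euler's identities. -/
theorem disc_pos (z : ℝ) :
    0 < 2 * E (f + z • e) * hess E (f + z • e) e e - fderiv ℝ E (f + z • e) e ^ 2 := by
  have h0 := h.line_ne_zero hf hef z
  have hE := h.energy_pos h0
  -- The vector `2E e - dE(e) y` is `D²E`-orthogonal to `y`, and its `D²E`-square is `2E` times the
  -- determinant.
  have h1 := h.hess_decomp hf hef (u := 0) (u' := 0) (by simp) (by simp) (by simp) (by simp) z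
    (2 * E (f + z • e)) (-fderiv ℝ E (f + z • e) e) (2 * E (f + z • e))
    (-fderiv ℝ E (f + z • e) e)
  have h2 := h.posDef _ h0 ((2 * E (f + z • e)) • e +
    (-fderiv ℝ E (f + z • e) e) • (f + z • e) + 0) (by
      intro hm
      have h3 := congrArg (a f) hm
      have h4 := congrArg (a e) hm
      simp only [map_add, map_smul, smul_eq_mul, map_zero, h.symm f e, hef, h.unit, hf] at h3 h4
      have h5 : fderiv ℝ E (f + z • e) e = 0 := by linarith
      rw [h5] at h4
      linarith)
  rw [h1] at h2
  simp only [map_zero] at h2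
  refine pos_of_mul_pos_right (a := 2 * E (f + z • e)) ?_ (by positivity)
  nlinarith

end IsAxialEnergy

end Axial

/-! ### The trace equation on the axis direction and its consequence for the energy -/

section AxialTrace

open SmoothOffZero

variable {n : ℕ} {a : EuclideanSpace ℝ (Fin n) →L[ℝ] EuclideanSpace ℝ (Fin n) →L[ℝ] ℝ}
  {e f : EuclideanSpace ℝ (Fin n)} {E : EuclideanSpace ℝ (Fin n) → ℝ}

namespace IsAxialEnergy

/-- Two linear conditions leave a nonzero vector in dimension at least three. -/
theorem exists_unit_perp (h : IsAxialEnergy a e E) (hn : 3 ≤ n) (f : EuclideanSpace ℝ (Fin n)) :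
    ∃ u, a e u = 0 ∧ a f u = 0 ∧ a u u = 1 := by
  have h1 : LinearMap.ker ((a e).toLinearMap.prod (a f).toLinearMap) ≠ ⊥ :=
    LinearMap.ker_ne_bot_of_finrank_lt (by
      simp only [Module.finrank_prod, Module.finrank_self, finrank_euclideanSpace,
        Fintype.card_fin]
      omega)
  obtain ⟨v, hv, hv0⟩ := Submodule.exists_mem_ne_zero_of_ne_bot h1
  have hv1 : a e v = 0 ∧ a f v = 0 := by simpa using hv
  have hp := h.pos v hv0
  refine ⟨(Real.sqrt (a v v))⁻¹ • v, by simp [hv1.1], by simp [hv1.2], ?_⟩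
  have hs := Real.mul_self_sqrt hp.le
  have hs0 : Real.sqrt (a v v) ≠ 0 := (Real.sqrt_pos.2 hp).ne'
  simp only [map_smul, smul_apply, smul_eq_mul]
  field_simp
  nlinarith

variable (h : IsAxialEnergy a e E) (hn : 3 ≤ n) (hf : a f f = 1) (hef : a e f = 0)
include h hn hf hef

/-- By `hess_perp` this number is `D²E(u,u)` for a unit vector `u` orthogonal to `e` and `f`. -/
theorem fderiv_self_pos (z : ℝ) : 0 < fderiv ℝ E (f + z • e) f := by
  obtain ⟨u, hu, hu2, huu⟩ := h.exists_unit_perp hn f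
  have h1 := h.hess_perp hf hef hu2 hu hu2 z
  rw [huu, one_mul] at h1
  rw [← h1]
  refine h.posDef _ (h.line_ne_zero hf hef z) u ?_
  rintro rfl
  simp at huu

/-- The trace of the third derivative in the direction of the axis. -/
theorem trace_third (z : ℝ) :
    ∑ j, ∑ k, (gramMatrix (fun u w => hess E (f + z • e) u w))⁻¹ j k *
        third E (f + z • e) e (coordVec j) (coordVec k) =
      (n - 2) * hess E (f + z • e) e f / fderiv ℝ E (f + z • e) f +
        2 * E (f + z • e) * third E (f + z • e) e e e /
          (2 * E (f + z • e) * hess E (f + z • e) e e - fderiv ℝ E (f + z • e) e ^ 2) := by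
  have h0 := h.line_ne_zero hf hef z
  have hE := h.energy_pos h0
  have hσ := h.fderiv_self_pos hn hf hef z
  have hD := h.disc_pos hf hef z
  have hdec := h.exists_decomp hf hef z
  have hH := fun u u' hu hu2 hu' hu2' => h.hess_decomp hf hef (u := u) (u' := u')
    hu hu2 hu' hu2' z
  have hT := fun u u' hu hu2 hu' hu2' => h.third_decomp hf hef (u := u) (u' := u')
    hu hu2 hu' hu2' z
  have hpos := h.posDef _ h0
  have hsymm := h.smooth.hess_symm h0
  have hyy : hess E (f + z • e) (f + z • e) (f + z • e) = 2 * E (f + z • e) := by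
    rw [h.smooth.hess_self h.homogeneous h0, h.smooth.fderiv_self h.homogeneous h0]
  generalize hess E (f + z • e) e f = τ at *
  generalize fderiv ℝ E (f + z • e) f = σ at *
  generalize fderiv ℝ E (f + z • e) e = p at *
  generalize third E (f + z • e) e e e = t at *
  generalize third E (f + z • e) = T at *
  generalize E (f + z • e) = ψ at *
  generalize hess E (f + z • e) = H at *
  generalize f + z • e = y at *
  generalize hq : H e e = q at *
  -- The form `T e` kills `y` and is `τ/σ` times `H` on the complement of `e` and `y`. So it is
  -- `τ/σ` times the angular form plus a multiple of the square of `H(·, m)`, with `m = 2ψ e - p y`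
  -- orthogonal to `y`. The coefficient is fixed by `T e e e = t` and `H(e,m) = 2ψq - p²`. The two
  -- traces are `n - 1` and `H(m,m) = 2ψ(2ψq - p²)`.
  have key : ∀ v w, T e v w = τ / σ * (H v w - 1 / (2 * ψ) * (H v y * H w y)) +
      (t - τ * (2 * ψ * q - p ^ 2) / (2 * ψ * σ)) / (2 * ψ * q - p ^ 2) ^ 2 *
        (H v ((2 * ψ) • e + (-p) • y + 0) * H w ((2 * ψ) • e + (-p) • y + 0)) := by
    intro v w
    obtain ⟨A, B, u, hu, hu2, rfl⟩ := hdec v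
    obtain ⟨A', B', u', hu', hu2', rfl⟩ := hdec w
    have y0 : y = (0 : ℝ) • e + (1 : ℝ) • y + 0 := by simp
    have e1 : ∀ A B u, a e u = 0 → a f u = 0 → H (A • e + B • y + u) y = A * p + 2 * B * ψ := by
      intro A B u hu hu2
      have := hH u 0 hu hu2 (by simp) (by simp) A B 0 1
      rw [← y0] at this
      rw [this]
      simp
    rw [hT u u' hu hu2 hu' hu2', hH u u' hu hu2 hu' hu2', e1 A B u hu hu2, e1 A' B' u' hu' hu2',
      hH u 0 hu hu2 (by simp) (by simp), hH u' 0 hu' hu2' (by simp) (by simp)]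
    have hD0 : 2 * ψ * q - p ^ 2 ≠ 0 := hD.ne'
    have m1 : ∀ A B : ℝ, A * (2 * ψ) * q + (A * -p + 2 * ψ * B) * p + 2 * B * -p * ψ +
        0 = A * (2 * ψ * q - p ^ 2) := fun A B => by ring
    simp only [map_zero, zero_mul, m1]
    generalize a u u' = s
    obtain ⟨D, rfl⟩ : ∃ D, q = (D + p ^ 2) / (2 * ψ) :=
      ⟨2 * ψ * q - p ^ 2, by field_simp; ring⟩
    have hDD : 2 * ψ * ((D + p ^ 2) / (2 * ψ)) - p ^ 2 = D := by field_simp; ring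
    rw [hDD] at hD0 ⊢
    field_simp
    ring
  have hmm := hH 0 0 (by simp) (by simp) (by simp) (by simp) (2 * ψ) (-p) (2 * ψ) (-p)
  have s1 := sum_gramMatrix_inv_mul hsymm hpos
  have s2 := sum_gramMatrix_inv_mul_mul hpos y
  have s3 := sum_gramMatrix_inv_mul_mul hpos ((2 * ψ) • e + (-p) • y + 0)
  have expand : ∀ (g : Matrix (Fin n) (Fin n) ℝ) (H : Fin n → Fin n → ℝ) (Y N : Fin n → ℝ) (α β γ : ℝ),
      ∑ j, ∑ k, g j k * (α * (H j k - β * (Y j * Y k)) + γ * (N j * N k)) =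
        α * (∑ j, ∑ k, g j k * H j k - β * ∑ j, ∑ k, g j k * (Y j * Y k)) +
          γ * ∑ j, ∑ k, g j k * (N j * N k) := by
    intro g H Y N α β γ
    simp only [Finset.mul_sum, ← Finset.sum_sub_distrib, ← Finset.sum_add_distrib]
    exact Finset.sum_congr rfl fun j _ => Finset.sum_congr rfl fun k _ => by ring
  simp only [key]
  refine (expand (gramMatrix fun u w => H u w)⁻¹ (fun j k => H (coordVec j) (coordVec k))
    (fun j => H (coordVec j) y)
    (fun j => H (coordVec j) ((2 * ψ) • e + (-p) • y + 0)) _ _ _).trans ?_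
  rw [s1, s2, s3, hmm, hyy]
  have hD0 : 2 * ψ * q - p ^ 2 ≠ 0 := hD.ne'
  simp only [map_zero, zero_mul]
  obtain ⟨D, rfl⟩ : ∃ D, q = (D + p ^ 2) / (2 * ψ) :=
    ⟨2 * ψ * q - p ^ 2, by field_simp; ring⟩
  have hDD : 2 * ψ * ((D + p ^ 2) / (2 * ψ)) - p ^ 2 = D := by field_simp; ring
  rw [hDD] at hD0 ⊢
  field_simp
  ring

/-- If the trace of the third derivative vanishes wherever the energy is not locally quadratic,
then the energy is a quadratic form. -/
theorem exists_quadratic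
    (htr : ∀ z : ℝ, hess E (f + z • e) e f ≠ 0 →
      ∑ j, ∑ k, (gramMatrix (fun u w => hess E (f + z • e) u w))⁻¹ j k *
        third E (f + z • e) e (coordVec j) (coordVec k) = 0) :
    ∃ c k : ℝ, ∀ y, 2 * E y = c * a y y + k * a e y ^ 2 := by
  have h0 := h.line_ne_zero hf hef
  have hline := fun z : ℝ => hasDerivAt_line f e z
  obtain ⟨c, k, hck⟩ := exists_quadratic_of_ode (m := (n : ℝ) - 2)
    (ψ := fun z => E (f + z • e)) (ψ₁ := fun z => fderiv ℝ E (f + z • e) e)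
    (ψ₂ := fun z => hess E (f + z • e) e e) (ψ₃ := fun z => third E (f + z • e) e e e)
    (by
      have : (3 : ℝ) ≤ n := by exact_mod_cast hn
      linarith)
    (fun z => h.smooth.hasDerivAt_comp (hline z) (h0 z))
    (fun z => by
      simpa using h.smooth.hasDerivAt_fderiv (hline z) (h0 z) (hasDerivAt_const z e))
    (fun z => by
      simpa using h.smooth.hasDerivAt_hess (hline z) (h0 z) (hasDerivAt_const z e)
        (hasDerivAt_const z e))
    (by
      have h1 : Continuous fun z : ℝ => third E (f + z • e) := by
        refine continuous_iff_continuousAt.2 fun z => ?_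
        exact ContinuousAt.comp (f := fun z : ℝ => f + z • e)
          (h.smooth.contDiffAt_third (h0 z)).continuousAt (hline z).continuousAt
      exact ((h1.clm_apply continuous_const).clm_apply continuous_const).clm_apply
        continuous_const)
    (fun z => h.energy_pos (h0 z))
    (fun z => by
      rw [← h.fderiv_self_line hf hef z]
      exact h.fderiv_self_pos hn hf hef z)
    (h.disc_pos hf hef)
    (fun z hz => by
      have hσ := (h.fderiv_self_pos hn hf hef z).ne'
      have hD := (h.disc_pos hf hef z).ne'
      rw [← h.hess_axis_self hf hef z] at hz ⊢
      rw [← h.fderiv_self_line hf hef z]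
      have h1 := htr z hz
      rw [h.trace_third hn hf hef z] at h1
      generalize 2 * E (f + z • e) * hess E (f + z • e) e e - fderiv ℝ E (f + z • e) e ^ 2 = D
        at *
      field_simp at h1
      linear_combination h1)
  have hplane : ∀ s t : ℝ, 0 < s → 2 * E (t • e + s • f) = c * s ^ 2 + k * t ^ 2 := by
    intro s t hs
    have h1 : t • e + s • f = s • (f + (t / s) • e) := by
      rw [smul_add, smul_smul, mul_div_cancel₀ _ hs.ne', add_comm]
    rw [h1, h.homogeneous _ _ hs]
    have h2 := hck (t / s)
    have h3 : s ^ 2 * (k * (t / s) ^ 2) = k * t ^ 2 := by field_simp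
    linear_combination s ^ 2 * h2 + h3
  -- With `s` and `t` the components along `f` and `e`, `a y y = s² + t²`, so `c s² + k t² = c
  -- a(y,y) + (k - c) t²`.
  refine ⟨c, k - c, fun y => ?_⟩
  set t := a e y with ht
  have hv : a (y - t • e) (y - t • e) = a y y - t ^ 2 := by
    simp only [map_sub, sub_apply, map_smul, smul_apply, smul_eq_mul, h.unit, h.symm y e, ← ht]
    ring
  by_cases hy : y - t • e = 0
  · have hyt : y = t • e := sub_eq_zero.1 hy
    have hyy : a y y = t ^ 2 := by
      rw [hy] at hv
      simp only [map_zero] at hv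
      linarith
    by_cases ht0 : t = 0
    · rw [hyy, hyt, ht0, zero_smul, h.energy_zero]
      ring
    have hyne : y ≠ 0 := by
      intro hy0
      rw [hy0] at ht
      simp at ht
      exact ht0 ht
    -- A nonzero vector on the axis is a limit of vectors of the open half plane `s > 0`, where the
    -- formula is known.
    have l1 : Filter.Tendsto (fun s : ℝ => 2 * E (t • e + s • f)) (nhdsWithin 0 (Set.Ioi 0))
        (nhds (2 * E y)) := by
      have h2 : ContinuousAt (fun s : ℝ => E (t • e + s • f)) 0 :=
        (h.smooth.hasDerivAt_comp (hasDerivAt_line (t • e) f 0)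
          (by simpa [← hyt] using hyne)).continuousAt
      have h3 : Filter.Tendsto (fun s : ℝ => 2 * E (t • e + s • f)) (nhds 0)
          (nhds (2 * E (t • e + (0 : ℝ) • f))) := (h2.const_mul 2).tendsto
      have h4 : t • e + (0 : ℝ) • f = y := by rw [zero_smul, add_zero, ← hyt]
      rw [h4] at h3
      exact h3.mono_left nhdsWithin_le_nhds
    have l2 : Filter.Tendsto (fun s : ℝ => c * s ^ 2 + k * t ^ 2) (nhdsWithin 0 (Set.Ioi 0))
        (nhds (c * 0 ^ 2 + k * t ^ 2)) := by
      have : Continuous fun s : ℝ => c * s ^ 2 + k * t ^ 2 := by fun_prop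
      exact (this.tendsto 0).mono_left nhdsWithin_le_nhds
    have l3 := tendsto_nhds_unique l1 (l2.congr' (by
      filter_upwards [self_mem_nhdsWithin] with s hs
      exact (hplane s t hs).symm))
    rw [l3, hyy]
    ring
  · have hp := h.pos _ hy
    rw [hv] at hp
    have hs := Real.sq_sqrt hp.le
    -- Axial symmetry moves a vector off the axis into the half plane of `e` and `f` with `s > 0`.
    have h1 : E y = E (t • e + Real.sqrt (a y y - t ^ 2) • f) := by
      apply h.axial
      · simp only [map_add, add_apply, map_smul, smul_apply, smul_eq_mul, h.unit, h.symm f e,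
          hef, hf]
        linear_combination -hs
      · simp [h.unit, hef, ht]
    rw [h1, hplane _ _ (Real.sqrt_pos.2 hp), hs]
    ring

end IsAxialEnergy

end AxialTrace

/-! ### Riemannian metrics from fibrewise quadratic forms -/

section BilinearForms

variable {n : ℕ}

/-- The unit sublevel set of a positive definite form is bounded. -/
theorem isVonNBounded_of_posDef
    {B : EuclideanSpace ℝ (Fin n) →L[ℝ] EuclideanSpace ℝ (Fin n) →L[ℝ] ℝ}
    (hB : ∀ v, v ≠ 0 → 0 < B v v) :
    Bornology.IsVonNBounded ℝ {v : EuclideanSpace ℝ (Fin n) | B v v < 1} := by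
  rw [NormedSpace.isVonNBounded_iff]
  rcases (Metric.sphere (0 : EuclideanSpace ℝ (Fin n)) 1).eq_empty_or_nonempty with h | h
  -- The unit sphere is empty only when the space is zero.
  · refine (Metric.isBounded_closedBall (x := 0) (r := 0)).subset fun v _ => ?_
    by_contra hv
    have hv0 : ‖v‖ ≠ 0 := by
      simpa using hv
    have : ‖v‖⁻¹ • v ∈ Metric.sphere (0 : EuclideanSpace ℝ (Fin n)) 1 := by
      simp [norm_smul, hv0]
    simp [h] at this
  · obtain ⟨w, hw, hmin⟩ := (isCompact_sphere (0 : EuclideanSpace ℝ (Fin n)) 1).exists_isMinOn h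
      (f := fun v => B v v) (by fun_prop)
    have hw0 : w ≠ 0 := by
      rintro rfl
      simp at hw
    have hm := hB w hw0
    refine (Metric.isBounded_closedBall (x := 0) (r := Real.sqrt (1 / B w w))).subset
      fun v hv => ?_
    rw [mem_closedBall_zero_iff]
    refine Real.le_sqrt_of_sq_le ?_
    by_cases hv0 : v = 0
    · simp only [hv0, norm_zero]
      exact (by positivity : (0 : ℝ) ≤ 1 / B w w).trans' (by norm_num)
    have hvn : ‖v‖ ≠ 0 := norm_ne_zero_iff.2 hv0
    have h1 : B w w ≤ B (‖v‖⁻¹ • v) (‖v‖⁻¹ • v) := hmin (by simp [norm_smul, hvn])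
    simp only [map_smul, smul_apply, smul_eq_mul] at h1
    have h2 : B v v < 1 := hv
    have h3 : ‖v‖⁻¹ * (‖v‖⁻¹ * B v v) * ‖v‖ ^ 2 = B v v := by field_simp
    have h4 := mul_le_mul_of_nonneg_right h1 (sq_nonneg ‖v‖)
    rw [le_div_iff₀ hm]
    linarith

/-- The elementary bilinear form `(v, w) ↦ vⁱ wʲ`. -/
def elemBilin (i j : Fin n) :
    EuclideanSpace ℝ (Fin n) →L[ℝ] EuclideanSpace ℝ (Fin n) →L[ℝ] ℝ :=
  (EuclideanSpace.proj i : EuclideanSpace ℝ (Fin n) →L[ℝ] ℝ).smulRight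
    (EuclideanSpace.proj j : EuclideanSpace ℝ (Fin n) →L[ℝ] ℝ)

theorem sum_elemBilin
    (A : EuclideanSpace ℝ (Fin n) →L[ℝ] EuclideanSpace ℝ (Fin n) →L[ℝ] ℝ) :
    ∑ i, ∑ j, A (coordVec i) (coordVec j) • elemBilin i j = A := by
  ext v w
  conv_rhs => rw [← sum_mul_apply_coordVec]
  simp only [sum_apply, smul_apply, smul_eq_mul]
  refine Finset.sum_congr rfl fun i _ => ?_
  conv_rhs => rw [← sum_coordVec w]
  simp only [map_sum, map_smul, smul_eq_mul, Finset.mul_sum]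
  refine Finset.sum_congr rfl fun j _ => ?_
  simp [elemBilin]
  ring

theorem coordVec_add_ne_zero (i j : Fin n) : coordVec i + coordVec j ≠ 0 := by
  intro h
  have := congrArg (fun v : EuclideanSpace ℝ (Fin n) => v i) h
  by_cases hij : i = j <;> simp [coordVec, hij] at this

theorem coordVec_ne_zero (i : Fin n) : coordVec i ≠ (0 : EuclideanSpace ℝ (Fin n)) := by
  simp [coordVec]

end BilinearForms

/-! ### Smoothness of the fibrewise form and reduction to a Riemannian metric -/

section Glue

variable {n : ℕ} {M : Type*} [TopologicalSpace M] [ChartedSpace (EuclideanSpace ℝ (Fin n)) M]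
  [IsManifold (𝓡 n) ∞ M]

theorem contMDiff_of_sq_eq {F : TangentBundle (𝓡 n) M → ℝ}
    (hF : ContMDiffOn (𝓡 n).tangent 𝓘(ℝ, ℝ) ∞ F {v | v.2 ≠ 0})
    {B : ∀ x : M, TangentSpace (𝓡 n) x →L[ℝ] TangentSpace (𝓡 n) x →L[ℝ] ℝ}
    (hs : ∀ (x : M) (u v : TangentSpace (𝓡 n) x), B x u v = B x v u)
    (hB : ∀ (x : M) (v : TangentSpace (𝓡 n) x), F (TotalSpace.mk x v) ^ 2 = B x v v) :
    ContMDiff (𝓡 n)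
      ((𝓡 n).prod 𝓘(ℝ, EuclideanSpace ℝ (Fin n) →L[ℝ] EuclideanSpace ℝ (Fin n) →L[ℝ] ℝ)) ∞
      (fun x => TotalSpace.mk' (EuclideanSpace ℝ (Fin n) →L[ℝ] EuclideanSpace ℝ (Fin n) →L[ℝ] ℝ)
        x (B x)) := by
  intro x₀
  rw [contMDiffAt_hom_bundle]
  refine ⟨contMDiffAt_id, ?_⟩
  set e := trivializationAt (EuclideanSpace ℝ (Fin n)) (TangentSpace (𝓡 n) (M := M)) x₀ with he
  have hx₀ : x₀ ∈ e.baseSet := mem_baseSet_trivializationAt _ _ x₀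
  have hsec : ∀ v : EuclideanSpace ℝ (Fin n), v ≠ 0 →
      ContMDiffAt (𝓡 n) 𝓘(ℝ, ℝ) ∞ (fun x => F (TotalSpace.mk x (e.symm x v))) x₀ := by
    intro v hv
    have h1 : ContMDiffOn (𝓡 n) (𝓡 n).tangent ∞
        (fun x => (TotalSpace.mk x (e.symm x v) : TangentBundle (𝓡 n) M)) e.baseSet := by
      have h2 := (e.contMDiffOn_symm (IB := 𝓡 n) (n := ∞)).comp (s := e.baseSet)
        (f := fun x => (x, v)) (I := 𝓡 n) (contMDiffOn_id.prodMk contMDiffOn_const)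
        (fun x hx => by simpa [e.target_eq] using hx)
      refine h2.congr fun x hx => ?_
      exact e.mk_symm hx v
    have h3 := hF.comp h1 (fun x hx => by
      intro h0
      have h4 := e.apply_mk_symm hx v
      have h5 : e.symm x v = 0 := h0
      rw [h5] at h4
      have h6 := e.zeroSection ℝ hx
      have h7 : ((x, 0) : M × EuclideanSpace ℝ (Fin n)) = (x, v) := h6.symm.trans h4
      exact hv (congrArg Prod.snd h7).symm)
    exact h3.contMDiffAt (e.open_baseSet.mem_nhds hx₀)
  have hentry : ∀ i j : Fin n, ContMDiffAt (𝓡 n) 𝓘(ℝ, ℝ) ∞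
      (fun x => B x (e.symm x (coordVec i)) (e.symm x (coordVec j))) x₀ := by
    intro i j
    -- Polarization of `F²` in the local frame. Only nonzero vectors may be inserted, as `F` is
    -- smooth off the zero section; `coordVec i + coordVec j` is nonzero even for `i = j`.
    have h1 := ((((hsec _ (coordVec_add_ne_zero i j)).pow 2).sub
      ((hsec _ (coordVec_ne_zero i)).pow 2)).sub ((hsec _ (coordVec_ne_zero j)).pow 2)).mul
        (contMDiffAt_const (c := (1 / 2 : ℝ)))
    refine h1.congr_of_eventuallyEq ?_
    filter_upwards [e.open_baseSet.mem_nhds hx₀] with x hx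
    have h2 : e.symm x (coordVec i + coordVec j) = e.symm x (coordVec i) + e.symm x (coordVec j) := by
      simpa only [e.symmL_apply hx] using map_add (e.symmL ℝ x) (coordVec i) (coordVec j)
    simp only [Pi.mul_apply, hB, h2, map_add, add_apply]
    rw [hs x (e.symm x (coordVec j))]
    ring
  have hsum : ContMDiffAt (𝓡 n)
      𝓘(ℝ, EuclideanSpace ℝ (Fin n) →L[ℝ] EuclideanSpace ℝ (Fin n) →L[ℝ] ℝ) ∞
      (fun x => ∑ i, ∑ j, B x (e.symm x (coordVec i)) (e.symm x (coordVec j)) • elemBilin i j)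
      x₀ := by
    refine ContMDiffAt.sum fun i _ => ContMDiffAt.sum fun j _ => ?_
    exact (hentry i j).smul contMDiffAt_const
  refine hsum.congr_of_eventuallyEq ?_
  filter_upwards [e.open_baseSet.mem_nhds hx₀] with x hx
  refine (sum_elemBilin _).symm.trans ?_
  refine Finset.sum_congr rfl fun i _ => Finset.sum_congr rfl fun j _ => ?_
  congr 1
  refine (inCoordinates_apply_eq₂ hx hx (Set.mem_univ _)).trans ?_
  simp [he]

/-- A Finsler metric whose square is a quadratic form on every tangent space is Riemannian. -/
theorem isRandersMetric_of_sq_eq {F : TangentBundle (𝓡 n) M → ℝ} (hF : IsFinslerMetric F)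
    {B : ∀ x : M, TangentSpace (𝓡 n) x →L[ℝ] TangentSpace (𝓡 n) x →L[ℝ] ℝ}
    (hs : ∀ (x : M) (u v : TangentSpace (𝓡 n) x), B x u v = B x v u)
    (hpos : ∀ (x : M) (v : TangentSpace (𝓡 n) x), v ≠ 0 → 0 < B x v v)
    (hB : ∀ (x : M) (v : TangentSpace (𝓡 n) x), F (TotalSpace.mk x v) ^ 2 = B x v v) :
    IsRandersMetric F := by
  refine ⟨⟨B, hs, hpos, fun x => isVonNBounded_of_posDef (hpos x),
    contMDiff_of_sq_eq hF.smooth hs hB⟩, 0, fun x => ?_, fun v => ?_⟩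
  · change Real.sqrt (∑ i, ∑ j, (gramMatrix fun u v : TangentSpace (𝓡 n) x => B x u v)⁻¹ i j *
      (0 : ℝ) * (0 : ℝ)) < 1
    simp
  · have h1 : OneForm.eval (0 : OneForm n M) v = 0 := by simp [OneForm.eval]
    rw [h1, add_zero]
    exact ((congrArg Real.sqrt (hB v.1 v.2)).symm.trans (Real.sqrt_sq (hF.nonneg v))).symm

end Glue

/-! ### The energy of a Finsler metric on a tangent space -/

section Fiber

variable {n : ℕ} {M : Type*} [TopologicalSpace M] [ChartedSpace (EuclideanSpace ℝ (Fin n)) M]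

/-- The energy `F²/2` on the tangent space at `x`. -/
def fiberEnergy (F : TangentBundle (𝓡 n) M → ℝ) (x : M) (y : EuclideanSpace ℝ (Fin n)) : ℝ :=
  1 / 2 * F (TotalSpace.mk (F := EuclideanSpace ℝ (Fin n)) (E := TangentSpace (𝓡 n)) x y) ^ 2

/-- In the trivialization at `x` the inclusion of the fibre is a linear map. -/
theorem contMDiff_fiber_mk [IsManifold (𝓡 n) ∞ M] (x : M) :
    ContMDiff 𝓘(ℝ, EuclideanSpace ℝ (Fin n)) (𝓡 n).tangent ∞
      (fun y : EuclideanSpace ℝ (Fin n) => (TotalSpace.mk x y : TangentBundle (𝓡 n) M)) := by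
  intro y
  rw [contMDiffAt_totalSpace]
  refine ⟨contMDiffAt_const, ?_⟩
  set e := trivializationAt (EuclideanSpace ℝ (Fin n)) (TangentSpace (𝓡 n) (M := M)) x with he
  have hx : x ∈ e.baseSet := mem_baseSet_trivializationAt _ _ x
  let A : EuclideanSpace ℝ (Fin n) →L[ℝ] EuclideanSpace ℝ (Fin n) := e.continuousLinearMapAt ℝ x
  refine (A.contMDiff.contMDiffAt (x := y)).congr_of_eventuallyEq
    (Filter.Eventually.of_forall fun v => ?_)
  exact (congrFun (e.coe_linearMapAt_of_mem (R := ℝ) hx) v).symm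

theorem smoothOffZero_fiberEnergy [IsManifold (𝓡 n) ∞ M] {F : TangentBundle (𝓡 n) M → ℝ}
    (hF : IsFinslerMetric F) (x : M) : SmoothOffZero (fiberEnergy F x) := by
  intro y hy
  have h1 : ContMDiffOn 𝓘(ℝ, EuclideanSpace ℝ (Fin n)) 𝓘(ℝ, ℝ) ∞
      (fun y : EuclideanSpace ℝ (Fin n) => F (TotalSpace.mk x y)) {y | y ≠ 0} :=
    hF.smooth.comp (contMDiff_fiber_mk x).contMDiffOn fun y hy => hy
  have h2 : ContDiffAt ℝ ∞ (fun y : EuclideanSpace ℝ (Fin n) => F (TotalSpace.mk x y)) y :=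
    (h1.contMDiffAt (isOpen_ne.mem_nhds hy)).contDiffAt
  exact contDiffAt_const.mul (h2.pow 2)

theorem fundamentalForm_eq {F : TangentBundle (𝓡 n) M → ℝ} {x : M}
    (hF : SmoothOffZero (fiberEnergy F x)) {y : EuclideanSpace ℝ (Fin n)} (hy : y ≠ 0)
    (u v : EuclideanSpace ℝ (Fin n)) :
    fundamentalForm F x y u v = hess (fiberEnergy F x) y u v := by
  rw [← hF.deriv_deriv hy u v]
  simp only [fiberEnergy, deriv_const_mul_field]
  rfl

theorem fiberEnergy_smul [IsManifold (𝓡 n) ∞ M] {F : TangentBundle (𝓡 n) M → ℝ}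
    (hF : IsFinslerMetric F) (x : M) (r : ℝ) (y : EuclideanSpace ℝ (Fin n)) (hr : 0 < r) :
    fiberEnergy F x (r • y) = r ^ 2 * fiberEnergy F x y := by
  have h : fiberEnergy F x (r • y) = 1 / 2 * (r * F (TotalSpace.mk x y)) ^ 2 :=
    congrArg (fun r : ℝ => 1 / 2 * r ^ 2) (hF.homogeneous x y r hr)
  rw [h, fiberEnergy]
  ring

theorem hess_fiberEnergy_pos [IsManifold (𝓡 n) ∞ M] {F : TangentBundle (𝓡 n) M → ℝ}
    (hF : IsFinslerMetric F) (x : M) (y : EuclideanSpace ℝ (Fin n)) (hy : y ≠ 0)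
    (u : EuclideanSpace ℝ (Fin n)) (hu : u ≠ 0) : 0 < hess (fiberEnergy F x) y u u := by
  rw [← fundamentalForm_eq (smoothOffZero_fiberEnergy hF x) hy]
  exact hF.posDef x y hy u hu

theorem fiberEnergy_pos [IsManifold (𝓡 n) ∞ M] {F : TangentBundle (𝓡 n) M → ℝ}
    (hF : IsFinslerMetric F) (x : M) {y : EuclideanSpace ℝ (Fin n)} (hy : y ≠ 0) :
    0 < fiberEnergy F x y := by
  have hsm := smoothOffZero_fiberEnergy hF x
  have h := hess_fiberEnergy_pos hF x y hy y hy
  rw [hsm.hess_self (fiberEnergy_smul hF x) hy, hsm.fderiv_self (fiberEnergy_smul hF x) hy] at h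
  linarith

theorem cartanTorsion_eq {F : TangentBundle (𝓡 n) M → ℝ} {x : M}
    (hF : SmoothOffZero (fiberEnergy F x)) {y : EuclideanSpace ℝ (Fin n)} (hy : y ≠ 0)
    (u v w : EuclideanSpace ℝ (Fin n)) :
    cartanTorsion F x y u v w = 1 / 2 * third (fiberEnergy F x) y w u v := by
  unfold cartanTorsion
  congr 1
  refine HasDerivAt.deriv ((hF.hasDerivAt_hess_line hy u v w).congr_of_eventuallyEq ?_)
  filter_upwards [SmoothOffZero.eventually_line_ne hy w] with r hr
  exact fundamentalForm_eq hF hr u v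

/-- Total symmetry of the third derivative moves `u` to the first slot, the form in which
`trace_third` computes the trace. -/
theorem meanCartanTorsion_eq {F : TangentBundle (𝓡 n) M → ℝ} {x : M}
    (hF : SmoothOffZero (fiberEnergy F x)) {y : EuclideanSpace ℝ (Fin n)} (hy : y ≠ 0)
    (u : EuclideanSpace ℝ (Fin n)) :
    meanCartanTorsion F x y u = 1 / 2 *
      ∑ j, ∑ k, (gramMatrix (fun u w => hess (fiberEnergy F x) y u w))⁻¹ j k *
        third (fiberEnergy F x) y u (coordVec j) (coordVec k) := by
  have h1 : gramMatrix (fundamentalForm F x y) =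
      gramMatrix (fun u w => hess (fiberEnergy F x) y u w) := by
    ext i j
    exact fundamentalForm_eq hF hy _ _
  unfold meanCartanTorsion
  rw [h1, Finset.mul_sum]
  refine Finset.sum_congr rfl fun j _ => ?_
  rw [Finset.mul_sum]
  refine Finset.sum_congr rfl fun k _ => ?_
  rw [cartanTorsion_eq hF hy, hF.third_symm_left hy, hF.third_symm_right hy u]
  ring

/-- For a C2-like metric with axially symmetric energy, the trace of the third derivative vanishes
wherever the energy is not locally quadratic. -/
theorem IsC2Like.trace_eq_zero {F : TangentBundle (𝓡 n) M → ℝ} (hC : IsC2Like F) (hn : 3 ≤ n)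
    {x : M} {a : EuclideanSpace ℝ (Fin n) →L[ℝ] EuclideanSpace ℝ (Fin n) →L[ℝ] ℝ}
    {e f : EuclideanSpace ℝ (Fin n)} (h : IsAxialEnergy a e (fiberEnergy F x)) (hf : a f f = 1)
    (hef : a e f = 0) (z : ℝ) (hτ : hess (fiberEnergy F x) (f + z • e) e f ≠ 0) :
    ∑ j, ∑ k, (gramMatrix (fun u w => hess (fiberEnergy F x) (f + z • e) u w))⁻¹ j k *
      third (fiberEnergy F x) (f + z • e) e (coordVec j) (coordVec k) = 0 := by
  have h0 := h.line_ne_zero hf hef z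
  obtain ⟨u, hu, hu2, huu⟩ := h.exists_unit_perp hn f
  have t1 := h.third_perp hf hef hu hu2 z
  have t2 := h.third_axis_perp hf hef hu2 hu hu2 z
  rw [huu, one_mul] at t2
  have hI := meanCartanTorsion_eq h.smooth h0 e
  obtain ⟨p, q, hsc, hp⟩ := hC
  by_contra hne
  have hIe : meanCartanTorsion F x (f + z • e) e ≠ 0 := by
    rw [hI]
    exact mul_ne_zero (by norm_num) hne
  obtain ⟨-, hCt⟩ := hsc x (f + z • e) h0 (fun hz => hIe (congrFun hz e))
  have hp0 := hp (TotalSpace.mk x (f + z • e)) h0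
  rw [hp0] at hCt
  simp only [zero_div, zero_mul, zero_add] at hCt
  have c1 := (cartanTorsion_eq h.smooth h0 u u u).symm.trans (hCt u u u)
  have c2 := (cartanTorsion_eq h.smooth h0 u u e).symm.trans (hCt u u e)
  rw [t1] at c1
  rw [t2] at c2
  generalize q _ / meanCartanNormSq F x (f + z • e) = κ at c1 c2
  generalize meanCartanTorsion F x (f + z • e) u = i at c1 c2
  have c3 : κ * (i * i * i) = 0 := by linarith
  -- `C(u,u,u) = 0` forces `κ = 0` or `I(u) = 0`; either way `C(u,u,e) = κ I(u)² I(e)` vanishes,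
  -- contradicting `τ ≠ 0`.
  have c4 : κ * (i * i) = 0 := by
    rcases mul_eq_zero.1 c3 with h1 | h1
    · rw [h1, zero_mul]
    · rcases mul_eq_zero.1 h1 with h2 | h2
      · rw [h2, mul_zero]
      · rw [h2, mul_zero, mul_zero]
  rw [← mul_assoc, c4, zero_mul] at c2
  exact hτ (by linarith)

end Fiber

/-! ### C2-like `(α,β)`-metrics on a single tangent space -/

section AlphaBeta

variable {n : ℕ} {M : Type*} [TopologicalSpace M] [ChartedSpace (EuclideanSpace ℝ (Fin n)) M]
  [IsManifold (𝓡 n) ∞ M]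

/-- A nonzero covector is proportional to the inner product with some unit vector. -/
theorem exists_unit_representative
    {a : EuclideanSpace ℝ (Fin n) →L[ℝ] EuclideanSpace ℝ (Fin n) →L[ℝ] ℝ}
    (ha : ∀ v, v ≠ 0 → 0 < a v v) {b : EuclideanSpace ℝ (Fin n) →L[ℝ] ℝ} (hb : b ≠ 0) :
    ∃ (e : EuclideanSpace ℝ (Fin n)) (c : ℝ), a e e = 1 ∧ ∀ v, b v = c * a e v := by
  let A : EuclideanSpace ℝ (Fin n) →ₗ[ℝ] Module.Dual ℝ (EuclideanSpace ℝ (Fin n)) :=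
    { toFun := fun v => (a v).toLinearMap
      map_add' := fun u v => by ext w; simp
      map_smul' := fun r v => by ext w; simp }
  have hinj : Function.Injective A := by
    rw [← LinearMap.ker_eq_bot, LinearMap.ker_eq_bot']
    intro v hv
    by_contra hv0
    have h1 : A v v = 0 := by rw [hv]; rfl
    exact (ha v hv0).ne' h1
  have hsurj : Function.Surjective A :=
    (LinearMap.injective_iff_surjective_of_finrank_eq_finrank
      Subspace.dual_finrank_eq.symm).1 hinj
  obtain ⟨w, hw⟩ := hsurj b.toLinearMap
  have hwb : ∀ v, a w v = b v := fun v => congrArg (fun l => l v) hw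
  have hw0 : w ≠ 0 := by
    rintro rfl
    refine hb (ContinuousLinearMap.ext fun v => ?_)
    rw [← hwb v]
    simp
  have hp := ha w hw0
  have hs0 : Real.sqrt (a w w) ≠ 0 := (Real.sqrt_pos.2 hp).ne'
  have hs := Real.mul_self_sqrt hp.le
  refine ⟨(Real.sqrt (a w w))⁻¹ • w, Real.sqrt (a w w), ?_, fun v => ?_⟩
  · simp only [map_smul, smul_apply, smul_eq_mul]
    field_simp
    nlinarith
  · rw [← hwb v]
    simp only [map_smul, smul_apply, smul_eq_mul]
    field_simp

/-- The square of a C2-like `(α,β)`-metric is a quadratic form on every tangent space. -/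
theorem IsC2Like.exists_sq_eq {F : TangentBundle (𝓡 n) M → ℝ} (hC : IsC2Like F) (hn : 3 ≤ n)
    {a : RiemMetric n M} {β : OneForm n M} {φ : ℝ → ℝ} {b₀ : EReal}
    (hF : IsAlphaBetaMetric F a β φ b₀) (x : M) :
    ∃ B : EuclideanSpace ℝ (Fin n) →L[ℝ] EuclideanSpace ℝ (Fin n) →L[ℝ] ℝ,
      (∀ u v, B u v = B v u) ∧
      ∀ v : EuclideanSpace ℝ (Fin n), 2 * fiberEnergy F x v = B v v := by
  obtain ⟨g, hg⟩ : ∃ g : EuclideanSpace ℝ (Fin n) →L[ℝ] EuclideanSpace ℝ (Fin n) →L[ℝ] ℝ,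
    g = a.inner x := ⟨_, rfl⟩
  obtain ⟨b, hb⟩ : ∃ b : EuclideanSpace ℝ (Fin n) →L[ℝ] ℝ, b = β x := ⟨_, rfl⟩
  have gsymm : ∀ u v, g u v = g v u := fun u v => by rw [hg]; exact a.symm x u v
  have gpos : ∀ v, v ≠ 0 → 0 < g v v := fun v hv => by rw [hg]; exact a.pos x v hv
  have hE : ∀ y, fiberEnergy F x y =
      1 / 2 * (Real.sqrt (g y y) * φ (b y / Real.sqrt (g y y))) ^ 2 := fun y => by
    rw [hg, hb]
    exact congrArg (fun r : ℝ => 1 / 2 * r ^ 2) (hF.eq (TotalSpace.mk x y))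
  -- Where `β` vanishes there is no axis, but there `F = φ(0) α`.
  by_cases hb0 : b = 0
  · refine ⟨φ 0 ^ 2 • g, fun u v => by simp [gsymm u v], fun v => ?_⟩
    have h1 : 0 ≤ g v v := by
      by_cases hv : v = 0
      · simp [hv]
      · exact (gpos v hv).le
    rw [hE, hb0]
    simp only [zero_apply, zero_div, mul_pow, Real.sq_sqrt h1, smul_apply, smul_eq_mul]
    ring
  obtain ⟨e, c, hee, hec⟩ := exists_unit_representative gpos hb0
  have hsm := smoothOffZero_fiberEnergy hF.finsler x
  have hax : IsAxialEnergy g e (fiberEnergy F x) :=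
    { smooth := hsm
      homogeneous := fiberEnergy_smul hF.finsler x
      posDef := hess_fiberEnergy_pos hF.finsler x
      symm := gsymm
      pos := gpos
      unit := hee
      axial := fun y y' h1 h2 => by rw [hE, hE, hec, hec, h1, h2] }
  -- The two orthogonality conditions coincide here; only a unit vector orthogonal to the axis is
  -- wanted.
  obtain ⟨f, hf1, -, hff⟩ := hax.exists_unit_perp hn e
  obtain ⟨c', k, hq⟩ := hax.exists_quadratic hn hff hf1
    (hC.trace_eq_zero hn hax hff hf1)
  refine ⟨c' • g + k • (g e).smulRight (g e), fun u v => ?_, fun v => ?_⟩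
  · simp only [add_apply, smul_apply, ContinuousLinearMap.smulRight_apply, smul_eq_mul, gsymm u v]
    ring
  · rw [hq]
    simp only [add_apply, smul_apply, ContinuousLinearMap.smulRight_apply, smul_eq_mul]
    ring

end AlphaBeta

end Finsler

end

theorem mainTheorem8 {n : ℕ} (hn : 3 ≤ n)
    {M : Type*} [TopologicalSpace M] [ChartedSpace (EuclideanSpace ℝ (Fin n)) M]
    [IsManifold (𝓡 n) ∞ M]
    (F : TangentBundle (𝓡 n) M → ℝ)
    (a : Finsler.RiemMetric n M) (β : Finsler.OneForm n M) (φ : ℝ → ℝ) (b₀ : EReal)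
    (hF : Finsler.IsAlphaBetaMetric F a β φ b₀)
    (hR : ¬ Finsler.IsRandersMetric F) :
    ¬ Finsler.IsC2Like F := by
  intro hC
  -- The forms are chosen point by point, with no regularity in `x`; `contMDiff_of_sq_eq` recovers
  -- smoothness from that of `F`.
  choose B hs hB using fun x => Finsler.IsC2Like.exists_sq_eq hC hn hF x
  have hsq : ∀ (x : M) (v : TangentSpace (𝓡 n) x), F (TotalSpace.mk x v) ^ 2 = B x v v := by
    intro x v
    have h : 2 * (1 / 2 * F (TotalSpace.mk x v) ^ 2) = B x v v := hB x v
    linarith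
  refine hR (Finsler.isRandersMetric_of_sq_eq hF.finsler (B := B) hs (fun x v hv => ?_) hsq)
  have h1 : 2 * Finsler.fiberEnergy F x v = B x v v := hB x v
  have h2 : 0 < Finsler.fiberEnergy F x v := Finsler.fiberEnergy_pos hF.finsler x hv
  exact h1 ▸ (by positivity : 0 < 2 * Finsler.fiberEnergy F x v)
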